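/- Let $m,n\ge 1$ be integers. A matrix $A\in\mathbb{Z}^{m\times n}$ is called an \emph{EQ matrix} if the homogeneous system $Ax=0$ has no non-trivial solution $x\in\{-1,0,1\}^n$, and its \emph{rate} is $R=n/m$. Then every EQ matrix $A$ of size $m\times n$ with all entries in $\{-1,0,1\}$ has rate $$R=\frac{n}{m}\le \frac12\log_2 n+1 .$$ -/

import Mathlib

/-- An integer matrix `A` of size `m × n` is an EQ matrix if the homogeneous system `A x = 0`
has no non-trivial solution `x` with all entries in `{-1, 0, 1}`. -/
def IsEQMatrix {m n : ℕ} (A : Matrix (Fin m) (Fin n) ℤ) : Prop :=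
  ∀ x : Fin n → ℤ, (∀ j, x j ∈ ({-1, 0, 1} : Set ℤ)) → A.mulVec x = 0 → x = 0

/-- The rate `R = n / m` of a matrix of size `m × n`, as a real number. -/
noncomputable def matrixRate {m n : ℕ} (_A : Matrix (Fin m) (Fin n) ℤ) : ℝ :=
  (n : ℝ) / (m : ℝ)

open MeasureTheory ProbabilityTheory Set Filter Topology
open scoped ENNReal NNReal Pointwise Matrix MatrixOrder

/-! Pass to a basis of the rows: `r ≤ m` independent rows with the same kernel. For `z` uniform on
`[-1, 1]^n`, estimate the probability that every coordinate of `A z` is at most `δ` in absolute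
value, and let `δ → 0`.

Upper bound (`pi_uniform_le_of_injective`): cut the cube into `2^n` unit cubes and translate them
all onto `(0, 1]^n`. By the EQ property the pieces of the event stay disjoint, and they lie where `A
z` is within `δ` of an integer vector. Since `A` induces a measure-preserving map of tori, that set
has volume at most `(2δ)^r`, so the probability is at most `2^(-n) (2δ)^r`.

Lower bound (`lintegral_pi_withDensity_le`): the uniform law is more peaked than the Gaussian
product law of maximal density `1/2`, and the event is a symmetric convex set. Under the Gaussian
law its probability is asymptotically `2^(-r) (2δ)^r / √det(A Aᵀ)`.

Together, `4^n ≤ 4^r det(A Aᵀ)`. The diagonal of `A Aᵀ` is at most `n`, so Hadamard's inequality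
gives `4^n ≤ (4n)^r ≤ (4n)^m`; take logarithms. -/

/-! ### Brunn–Minkowski and Prékopa–Leindler on the line -/

/-- The one-dimensional Brunn–Minkowski inequality for compact sets. -/
theorem volume_add_volume_le_of_isCompact {K L C : Set ℝ} (hK : IsCompact K) (hL : IsCompact L)
    (hKn : K.Nonempty) (hLn : L.Nonempty) {a b : ℝ} (ha : 0 < a) (hb : 0 < b)
    (h : ∀ x ∈ K, ∀ y ∈ L, a * x + b * y ∈ C) :
    ENNReal.ofReal a * volume K + ENNReal.ofReal b * volume L ≤ volume C := by
  -- With `u = max K` and `v = min L`, the sets `aK + bv` and `au + bL` both lie in `C` and meet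
  -- only at `au + bv`.
  obtain ⟨u, hu, hu'⟩ := hK.exists_isGreatest hKn
  obtain ⟨v, hv, hv'⟩ := hL.exists_isLeast hLn
  have h1 : volume ((b * v) +ᵥ (a • K)) = ENNReal.ofReal a * volume K := by
    rw [measure_vadd, Measure.addHaar_smul]
    simp [abs_of_pos ha]
  have h2 : volume ((a * u) +ᵥ (b • L)) = ENNReal.ofReal b * volume L := by
    rw [measure_vadd, Measure.addHaar_smul]
    simp [abs_of_pos hb]
  have hm : MeasurableSet ((a * u) +ᵥ (b • L)) :=
    ((hL.smul b).vadd _).measurableSet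
  rw [← h1, ← h2, ← measure_union₀ hm.nullMeasurableSet]
  · apply measure_mono
    rintro _ (⟨_, ⟨x, hx, rfl⟩, rfl⟩ | ⟨_, ⟨x, hx, rfl⟩, rfl⟩)
    · simpa [add_comm] using h x hx v hv
    · simpa using h u hu x hx
  · refine measure_mono_null (t := {a * u + b * v}) ?_ (by simp)
    rintro _ ⟨⟨_, ⟨x, hx, rfl⟩, rfl⟩, ⟨_, ⟨y, hy, rfl⟩, h3⟩⟩
    simp only [smul_eq_mul, vadd_eq_add, mem_singleton_iff] at h3 ⊢
    have := mul_le_mul_of_nonneg_left (hu' hx) ha.le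
    have := mul_le_mul_of_nonneg_left (hv' hy) hb.le
    linarith

/-- Inner regularity, with a point of `A` adjoined to each compact set because Brunn–Minkowski fails
for empty sets. -/
theorem volume_le_iSup_isCompact_nonempty {A : Set ℝ} (hA : MeasurableSet A) (hAn : A.Nonempty) :
    volume A ≤ ⨆ K : Set ℝ, ⨆ _ : K ⊆ A ∧ IsCompact K ∧ K.Nonempty, volume K := by
  obtain ⟨x, hx⟩ := hAn
  rw [hA.measure_eq_iSup_isCompact]
  refine iSup_le fun K => iSup_le fun hK => iSup_le fun hK' => ?_
  refine (measure_mono (subset_insert x K)).trans (le_iSup₂_of_le (insert x K) ⟨?_, ?_, ?_⟩ le_rfl)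
  · exact insert_subset hx hK
  · exact hK'.insert x
  · exact insert_nonempty x K

/-- The one-dimensional Brunn–Minkowski inequality. -/
theorem volume_add_volume_le {A B C : Set ℝ} (hA : MeasurableSet A) (hB : MeasurableSet B)
    (hAn : A.Nonempty) (hBn : B.Nonempty) {a b : ℝ} (ha : 0 < a) (hb : 0 < b)
    (h : ∀ x ∈ A, ∀ y ∈ B, a * x + b * y ∈ C) :
    ENNReal.ofReal a * volume A + ENNReal.ofReal b * volume B ≤ volume C := by
  refine (add_le_add (mul_le_mul_right (volume_le_iSup_isCompact_nonempty hA hAn) _)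
    (mul_le_mul_right (volume_le_iSup_isCompact_nonempty hB hBn) _)).trans ?_
  simp only [ENNReal.mul_iSup]
  have hex : ∀ {A : Set ℝ}, A.Nonempty → ∃ K, K ⊆ A ∧ IsCompact K ∧ K.Nonempty :=
    fun ⟨x, hx⟩ => ⟨{x}, by simpa using hx, isCompact_singleton, singleton_nonempty x⟩
  refine ENNReal.biSup_add_biSup_le' (hex hAn) (hex hBn) fun K hK L hL => ?_
  exact volume_add_volume_le_of_isCompact hK.2.1 hL.2.1 hK.2.2 hL.2.2 ha hb
    fun x hx y hy => h x (hK.1 hx) y (hL.1 hy)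

/-- Layer cake formula for a function with values in `[0, 1]`. -/
theorem lintegral_eq_lintegral_Ioo_volume_lt {f : ℝ → ℝ≥0∞} (hf : Measurable f) (h1 : ∀ x, f x ≤ 1) :
    ∫⁻ x, f x = ∫⁻ s in Ioo (0 : ℝ) 1, volume {x | ENNReal.ofReal s < f x} := by
  have hne : ∀ x, f x ≠ ∞ := fun x => ((h1 x).trans_lt ENNReal.one_lt_top).ne
  have key := lintegral_eq_lintegral_meas_lt (f := fun x => (f x).toReal) volume
    (Filter.Eventually.of_forall fun x => ENNReal.toReal_nonneg) hf.ennreal_toReal.aemeasurable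
  simp only [ENNReal.ofReal_toReal (hne _)] at key
  rw [key]
  have hset : ∀ s ∈ Ioi (0 : ℝ), {x | s < (f x).toReal} = {x | ENNReal.ofReal s < f x} := by
    intro s hs
    ext x
    simp only [mem_ofPred_eq]
    exact (ENNReal.ofReal_lt_iff_lt_toReal (le_of_lt hs) (hne x)).symm
  have h0 : ∫⁻ s in Ici (1 : ℝ), volume {x | ENNReal.ofReal s < f x} = 0 := by
    refine setLIntegral_eq_zero measurableSet_Ici fun s hs => ?_
    have : {x | ENNReal.ofReal s < f x} = ∅ := by
      ext x
      simp only [mem_ofPred_eq, mem_empty_iff_false, iff_false, not_lt]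
      exact (h1 x).trans (by simpa using hs)
    simp [this]
  rw [setLIntegral_congr_fun measurableSet_Ioi
      (g := fun s => volume {x | ENNReal.ofReal s < f x}) (fun s hs => by rw [hset s hs]),
    ← Ioo_union_Ici_eq_Ioi (zero_lt_one' ℝ), lintegral_union measurableSet_Ici, h0, add_zero]
  exact Set.disjoint_left.2 fun x hx hx' => absurd hx.2 (not_lt.2 hx')

theorem ENNReal.rpow_mul_rpow_le_add {a b : ℝ} (ha : 0 < a) (hb : 0 < b) (hab : a + b = 1)
    (x y : ℝ≥0∞) : x ^ a * y ^ b ≤ ENNReal.ofReal a * x + ENNReal.ofReal b * y := by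
  have ha' : ENNReal.ofReal a ≠ 0 := by simpa using ha
  have hb' : ENNReal.ofReal b ≠ 0 := by simpa using hb
  by_cases hx : x = ∞
  · simp [hx, ha']
  by_cases hy : y = ∞
  · simp [hy, hb']
  lift x to NNReal using hx
  lift y to NNReal using hy
  have := NNReal.geom_mean_le_arith_mean2_weighted a.toNNReal b.toNNReal x y
    (by rw [← Real.toNNReal_add ha.le hb.le, hab, Real.toNNReal_one])
  rw [Real.coe_toNNReal _ ha.le, Real.coe_toNNReal _ hb.le] at this
  rw [← ENNReal.coe_rpow_of_nonneg _ ha.le, ← ENNReal.coe_rpow_of_nonneg _ hb.le]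
  simp only [ENNReal.ofReal]
  exact_mod_cast this

/-- The one-dimensional Prékopa–Leindler inequality for functions of supremum `1`. -/
theorem prekopa_leindler_of_iSup_eq_one {f g h : ℝ → ℝ≥0∞} (hf : Measurable f) (hg : Measurable g)
    (hh : Measurable h) {a b : ℝ} (ha : 0 < a) (hb : 0 < b) (hab : a + b = 1)
    (hf1 : ⨆ x, f x = 1) (hg1 : ⨆ x, g x = 1)
    (H : ∀ x y, f x ^ a * g y ^ b ≤ h (a * x + b * y)) :
    (∫⁻ x, f x) ^ a * (∫⁻ x, g x) ^ b ≤ ∫⁻ x, h x := by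
  -- AM–GM makes the left side linear, so layer cake reduces it to Brunn–Minkowski for level sets.
  -- Suprema equal to `1` make these nonempty for every level below `1`.
  refine (ENNReal.rpow_mul_rpow_le_add ha hb hab _ _).trans ?_
  refine le_trans ?_ (lintegral_mono (fun x => min_le_left (h x) 1))
  rw [lintegral_eq_lintegral_Ioo_volume_lt hf fun x => hf1 ▸ le_iSup f x,
    lintegral_eq_lintegral_Ioo_volume_lt hg fun x => hg1 ▸ le_iSup g x,
    lintegral_eq_lintegral_Ioo_volume_lt (hh.min measurable_const) fun x => min_le_right _ _,
    ← lintegral_const_mul' _ _ ENNReal.ofReal_ne_top,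
    ← lintegral_const_mul' _ _ ENNReal.ofReal_ne_top]
  refine (le_lintegral_add _ _).trans (setLIntegral_mono' measurableSet_Ioo fun s hs => ?_)
  have hs1 : ENNReal.ofReal s < 1 := by simpa using hs.2
  refine volume_add_volume_le (hf measurableSet_Ioi) (hg measurableSet_Ioi) ?_ ?_ ha hb ?_
  · exact lt_iSup_iff.1 (hf1 ▸ hs1)
  · exact lt_iSup_iff.1 (hg1 ▸ hs1)
  · intro x hx y hy
    refine lt_min (lt_of_lt_of_le ?_ (H x y)) hs1
    calc ENNReal.ofReal s = ENNReal.ofReal s ^ a * ENNReal.ofReal s ^ b := by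
          rw [← ENNReal.rpow_add_of_nonneg _ _ ha.le hb.le, hab, ENNReal.rpow_one]
      _ < f x ^ a * g y ^ b := ENNReal.mul_lt_mul (ENNReal.rpow_lt_rpow hx ha)
          (ENNReal.rpow_lt_rpow hy hb)

/-- The one-dimensional Prékopa–Leindler inequality for bounded functions. -/
theorem prekopa_leindler {f g h : ℝ → ℝ≥0∞} (hf : Measurable f) (hg : Measurable g)
    (hh : Measurable h) {a b : ℝ} (ha : 0 < a) (hb : 0 < b) (hab : a + b = 1)
    (hf1 : ⨆ x, f x ≠ ∞) (hg1 : ⨆ x, g x ≠ ∞)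
    (H : ∀ x y, f x ^ a * g y ^ b ≤ h (a * x + b * y)) :
    (∫⁻ x, f x) ^ a * (∫⁻ x, g x) ^ b ≤ ∫⁻ x, h x := by
  set S := ⨆ x, f x with hS
  set T := ⨆ x, g x with hT
  by_cases hS0 : S = 0
  · have : ∀ x, f x = 0 := by simpa [hS] using hS0
    simp [this, ha]
  by_cases hT0 : T = 0
  · have : ∀ x, g x = 0 := by simpa [hT] using hT0
    simp [this, hb]
  have hc0 : S ^ a * T ^ b ≠ 0 := by
    simp [hS0, hT0, hf1, hg1, ENNReal.rpow_eq_zero_iff]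
  have hc1 : S ^ a * T ^ b ≠ ∞ :=
    ENNReal.mul_ne_top (ENNReal.rpow_ne_top_of_nonneg ha.le hf1)
      (ENNReal.rpow_ne_top_of_nonneg hb.le hg1)
  have hinv : ∀ x y : ℝ≥0∞, (S⁻¹ * x) ^ a * (T⁻¹ * y) ^ b =
      (S ^ a * T ^ b)⁻¹ * (x ^ a * y ^ b) := by
    intro x y
    rw [ENNReal.mul_rpow_of_nonneg _ _ ha.le, ENNReal.mul_rpow_of_nonneg _ _ hb.le,
      ENNReal.inv_rpow, ENNReal.inv_rpow, ENNReal.mul_inv (.inr ?_) (.inl ?_)]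
    · ring
    · exact ENNReal.rpow_ne_top_of_nonneg hb.le hg1
    · exact ENNReal.rpow_ne_top_of_nonneg ha.le hf1
  have key := prekopa_leindler_of_iSup_eq_one (f := fun x => S⁻¹ * f x) (g := fun x => T⁻¹ * g x)
    (h := fun x => (S ^ a * T ^ b)⁻¹ * h x) (hf.const_mul _) (hg.const_mul _) (hh.const_mul _)
    ha hb hab
    (by rw [← ENNReal.mul_iSup, ← hS, ENNReal.inv_mul_cancel hS0 hf1])
    (by rw [← ENNReal.mul_iSup, ← hT, ENNReal.inv_mul_cancel hT0 hg1])
    (fun x y => by rw [hinv]; gcongr; exact H x y)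
  rw [lintegral_const_mul _ hf, lintegral_const_mul _ hg, lintegral_const_mul _ hh, hinv] at key
  exact (ENNReal.mul_le_mul_iff_right (ENNReal.inv_ne_zero.2 hc1) (ENNReal.inv_ne_top.2 hc0)).1 key

/-! ### Log-concave functions and their marginals -/

/-- Log-concavity of a function with values in `[0, ∞]`. -/
def IsLogConcave {E : Type*} [AddCommGroup E] [Module ℝ E] (f : E → ℝ≥0∞) : Prop :=
  ∀ (x y : E) (a b : ℝ), 0 < a → 0 < b → a + b = 1 → f x ^ a * f y ^ b ≤ f (a • x + b • y)

namespace IsLogConcave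

variable {E E' : Type*} [AddCommGroup E] [Module ℝ E] [AddCommGroup E'] [Module ℝ E']

theorem mul {f g : E → ℝ≥0∞} (hf : IsLogConcave f) (hg : IsLogConcave g) :
    IsLogConcave fun x => f x * g x := by
  intro x y a b ha hb hab
  refine le_trans (le_of_eq ?_) (mul_le_mul' (hf x y a b ha hb hab) (hg x y a b ha hb hab))
  rw [ENNReal.mul_rpow_of_nonneg _ _ ha.le, ENNReal.mul_rpow_of_nonneg _ _ hb.le]
  ring

theorem comp_linearMap {f : E' → ℝ≥0∞} (hf : IsLogConcave f) (L : E →ₗ[ℝ] E') :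
    IsLogConcave fun x => f (L x) := by
  intro x y a b ha hb hab
  simpa using hf (L x) (L y) a b ha hb hab

theorem indicator_const {s : Set E} (hs : Convex ℝ s) (c : ℝ≥0∞) :
    IsLogConcave (s.indicator fun _ => c) := by
  intro x y a b ha hb hab
  by_cases hx : x ∈ s
  · by_cases hy : y ∈ s
    · rw [indicator_of_mem hx, indicator_of_mem hy, indicator_of_mem (hs hx hy ha.le hb.le hab),
        ← ENNReal.rpow_add_of_nonneg _ _ ha.le hb.le, hab, ENNReal.rpow_one]
    · simp [hy, hb]
  · simp [hx, ha]

/-- A marginal of a bounded log-concave function is log-concave. -/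
theorem lintegral {F : ℝ × E → ℝ≥0∞} (hF : IsLogConcave F)
    (hm : ∀ x, Measurable fun t => F (t, x)) {M : ℝ≥0∞} (hM : M ≠ ∞) (hFM : ∀ z, F z ≤ M) :
    IsLogConcave fun x => ∫⁻ t, F (t, x) := by
  intro x y a b ha hb hab
  refine prekopa_leindler (hm x) (hm y) (hm _) ha hb hab ?_ ?_ fun s t => ?_
  · exact ((iSup_le fun t => hFM _).trans_lt hM.lt_top).ne
  · exact ((iSup_le fun t => hFM _).trans_lt hM.lt_top).ne
  · simpa using hF (s, x) (t, y) a b ha hb hab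

theorem lintegral_withDensity {F : ℝ × E → ℝ≥0∞} (hF : IsLogConcave F)
    (hm : ∀ x, Measurable fun t => F (t, x)) {M : ℝ≥0∞} (hM : M ≠ ∞) (hFM : ∀ z, F z ≤ M)
    {q : ℝ → ℝ≥0∞} (hq : IsLogConcave q) (hqm : Measurable q) {N : ℝ≥0∞} (hN : N ≠ ∞)
    (hqN : ∀ z, q z ≤ N) :
    IsLogConcave fun x => ∫⁻ t, F (t, x) ∂(volume.withDensity q) := by
  have : IsLogConcave fun z : ℝ × E => q z.1 * F z :=
    (hq.comp_linearMap (LinearMap.fst ℝ ℝ E)).mul hF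
  convert this.lintegral (fun x => hqm.mul (hm x)) (ENNReal.mul_ne_top hN hM)
    (fun z => mul_le_mul' (hqN z.1) (hFM z)) using 2 with x
  rw [lintegral_withDensity_eq_lintegral_mul _ hqm (hm x)]
  rfl

/-- An even log-concave function on the line is decreasing on the positive half-line. -/
theorem le_of_abs_le {φ : ℝ → ℝ≥0∞} (hφ : IsLogConcave φ) (he : ∀ t, φ (-t) = φ t) {s t : ℝ}
    (hst : |s| ≤ |t|) : φ t ≤ φ s := by
  rcases hst.eq_or_lt with h | h
  · rcases abs_eq_abs.1 h with rfl | rfl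
    · rfl
    · rw [he]
  wlog ht : 0 < t generalizing t
  · have := this (t := -t) (by simpa using hst) (by simpa using h) ?_
    · rwa [he] at this
    · rcases lt_trichotomy t 0 with h' | rfl | h'
      · linarith
      · simp at h
        linarith [abs_nonneg s]
      · exact absurd h' ht
  rw [abs_of_pos ht, abs_lt] at h
  -- The weights writing `s` as a convex combination of `t` and `-t`.
  have ha : 0 < (t + s) / (2 * t) := div_pos (by linarith) (by linarith)
  have hb : 0 < (t - s) / (2 * t) := div_pos (by linarith) (by linarith)
  have hab : (t + s) / (2 * t) + (t - s) / (2 * t) = 1 := by field_simp; ring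
  have := hφ t (-t) _ _ ha hb hab
  rw [he, ← ENNReal.rpow_add_of_nonneg _ _ ha.le hb.le, hab, ENNReal.rpow_one] at this
  convert this using 2
  simp only [smul_eq_mul]
  field_simp
  ring

end IsLogConcave

/-! ### Peakedness of the uniform law on the cube -/

theorem lintegral_pi_succ {n : ℕ} {μ : Measure ℝ} [SigmaFinite μ] {F : (Fin (n + 1) → ℝ) → ℝ≥0∞}
    (hF : Measurable F) :
    ∫⁻ z, F z ∂(Measure.pi fun _ => μ) =
      ∫⁻ z, ∫⁻ t, F (Fin.cons t z) ∂μ ∂(Measure.pi fun _ : Fin n => μ) := by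
  have := (measurePreserving_piFinSuccAbove (fun _ : Fin (n + 1) => μ) 0).symm
  rw [← this.lintegral_comp hF, lintegral_prod_symm]
  · simp [MeasurableEquiv.piFinSuccAbove, Fin.insertNthEquiv]
  · exact (hF.comp this.measurable).aemeasurable

theorem measurable_finCons {n : ℕ} :
    Measurable fun z : ℝ × (Fin n → ℝ) => (Fin.cons z.1 z.2 : Fin (n + 1) → ℝ) := by
  refine measurable_pi_lambda _ fun i => ?_
  refine Fin.cases ?_ (fun j => ?_) i
  · simpa using measurable_fst
  · simpa using (measurable_pi_apply j).fun_comp measurable_snd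

/-- `Fin.cons` as a linear map. -/
def finConsLinearMap (n : ℕ) : ℝ × (Fin n → ℝ) →ₗ[ℝ] (Fin (n + 1) → ℝ) where
  toFun z := Fin.cons z.1 z.2
  map_add' x y := by ext i; refine Fin.cases ?_ (fun j => ?_) i <;> simp
  map_smul' c x := by ext i; refine Fin.cases ?_ (fun j => ?_) i <;> simp

section

variable {q : ℝ → ℝ≥0∞} {N : ℝ≥0∞} [IsProbabilityMeasure (volume.withDensity q)]

/-- Integrate out one coordinate at a time; the coordinates still to be integrated join the
parameter space `E`. -/
theorem IsLogConcave.lintegral_pi (hq : IsLogConcave q) (hqm : Measurable q) (hN : N ≠ ∞)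
    (hqN : ∀ z, q z ≤ N) {E : Type*} [AddCommGroup E] [Module ℝ E] [MeasurableSpace E] {n : ℕ}
    {F : (Fin n → ℝ) × E → ℝ≥0∞} (hF : IsLogConcave F) (hm : Measurable F) (hF1 : ∀ z, F z ≤ 1) :
    IsLogConcave fun x => ∫⁻ z, F (z, x) ∂(Measure.pi fun _ : Fin n => volume.withDensity q) := by
  induction n with
  | zero =>
    convert hF.comp_linearMap (LinearMap.inr ℝ (Fin 0 → ℝ) E) using 2 with x
    rw [Measure.pi_of_empty, lintegral_dirac']
    · simp only [LinearMap.inr_apply]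
      congr
      exact Subsingleton.elim _ _
    · exact hm.comp measurable_prodMk_right
  | succ n ih =>
    have hm' : Measurable fun z : ℝ × ((Fin n → ℝ) × E) =>
        F ((Fin.cons z.1 z.2.1 : Fin (n + 1) → ℝ), z.2.2) :=
      hm.comp ((measurable_finCons.comp
        (measurable_fst.prodMk (measurable_fst.comp measurable_snd))).prodMk
          (measurable_snd.comp measurable_snd))
    let T : ℝ × ((Fin n → ℝ) × E) →ₗ[ℝ] (Fin (n + 1) → ℝ) × E :=
      ((finConsLinearMap n).comp (LinearMap.prodMap .id (.fst ℝ _ _))).prod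
        ((LinearMap.snd ℝ _ _).comp (.snd ℝ _ _))
    have hG := IsLogConcave.lintegral_withDensity (hF.comp_linearMap T)
      (fun x => hm'.comp measurable_prodMk_right) ENNReal.one_ne_top (fun z => hF1 _) hq hqm hN hqN
    convert ih hG hm'.lintegral_prod_left' (fun z => ?_) using 2 with x
    · exact lintegral_pi_succ (hm.comp measurable_prodMk_right)
    · exact (lintegral_mono fun t => hF1 _).trans (by simp)

/-- The uniform law on `[-1, 1]` is more peaked than any law with density at most `1/2`. -/
theorem lintegral_withDensity_le_of_even (hqm : Measurable q) (hq2 : ∀ z, q z ≤ 2⁻¹)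
    {φ : ℝ → ℝ≥0∞} (hφ : IsLogConcave φ) (he : ∀ t, φ (-t) = φ t) (hm : Measurable φ) :
    ∫⁻ t, φ t ∂(volume.withDensity q) ≤
      ∫⁻ t, φ t ∂(volume.withDensity ((Icc (-1 : ℝ) 1).indicator fun _ => 2⁻¹)) := by
  set I := Icc (-1 : ℝ) 1 with hI
  have hIm : MeasurableSet I := measurableSet_Icc
  have hin : ∀ t ∈ I, φ 1 ≤ φ t := fun t ht => hφ.le_of_abs_le he (by simpa using abs_le.2 ht)
  have hout : ∀ t ∈ Iᶜ, φ t ≤ φ 1 := fun t ht => hφ.le_of_abs_le he <| by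
    rw [abs_one]
    by_contra! h
    exact ht (abs_le.1 h.le)
  have hv : volume I = 2 := by simp [hI]; norm_num
  have hmass : (∫⁻ t in I, q t) + ∫⁻ t in Iᶜ, q t = 1 := by
    rw [lintegral_add_compl _ hIm]
    rw [← setLIntegral_univ, ← withDensity_apply _ MeasurableSet.univ, measure_univ]
  have hmass' : (∫⁻ t in I, q t) + ∫⁻ t in I, (2⁻¹ - q t) = 1 := by
    rw [← lintegral_add_left hqm, setLIntegral_congr_fun hIm
      (g := fun _ => 2⁻¹) (fun t _ => add_tsub_cancel_of_le (hq2 t))]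
    simp [hv, ENNReal.inv_mul_cancel]
  have hfin : ∫⁻ t in I, q t ≠ ∞ :=
    ((le_self_add.trans hmass.le).trans_lt ENNReal.one_lt_top).ne
  -- Mass of `q` outside `I` equals its deficit inside. Moving it inside cannot lower the integral,
  -- as `φ 1` bounds `φ` from above outside and from below inside.
  have hdef : ∫⁻ t in Iᶜ, q t = ∫⁻ t in I, (2⁻¹ - q t) :=
    (ENNReal.add_right_inj hfin).1 (hmass.trans hmass'.symm)
  rw [lintegral_withDensity_eq_lintegral_mul _ hqm hm,
    lintegral_withDensity_eq_lintegral_mul _ (measurable_const.indicator hIm) hm,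
    ← lintegral_add_compl (q * φ) hIm,
    ← lintegral_add_compl ((I.indicator fun _ => 2⁻¹) * φ) hIm]
  have e1 : ∫⁻ t in I, I.indicator (fun _ => 2⁻¹) t * φ t =
      (∫⁻ t in I, q t * φ t) + ∫⁻ t in I, (2⁻¹ - q t) * φ t := by
    rw [← lintegral_add_left (f := fun t => q t * φ t) (hqm.mul hm)]
    refine setLIntegral_congr_fun hIm fun t ht => ?_
    simp only [indicator_of_mem ht, ← add_mul, add_tsub_cancel_of_le (hq2 t)]
  have e2 : ∫⁻ t in Iᶜ, q t * φ t ≤ ∫⁻ t in I, (2⁻¹ - q t) * φ t := by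
    calc ∫⁻ t in Iᶜ, q t * φ t ≤ ∫⁻ t in Iᶜ, q t * φ 1 :=
          setLIntegral_mono' hIm.compl fun t ht => mul_le_mul_right (hout t ht) _
      _ = ∫⁻ t in I, (2⁻¹ - q t) * φ 1 := by
          rw [lintegral_mul_const _ hqm, hdef, lintegral_mul_const (f := fun t => 2⁻¹ - q t) _
            (measurable_const.sub hqm)]
      _ ≤ _ := setLIntegral_mono' hIm fun t ht => mul_le_mul_right (hin t ht) _
  simp only [Pi.mul_apply]
  rw [e1, add_assoc]
  gcongr
  exact e2.trans le_self_add

instance isProbabilityMeasure_uniform : IsProbabilityMeasure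
    (volume.withDensity ((Icc (-1 : ℝ) 1).indicator fun _ => (2⁻¹ : ℝ≥0∞))) := by
  constructor
  rw [withDensity_apply _ MeasurableSet.univ, setLIntegral_univ,
    lintegral_indicator measurableSet_Icc]
  simp only [lintegral_const, Measure.restrict_apply_univ, Real.volume_Icc]
  norm_num
  exact ENNReal.inv_mul_cancel (by simp) (by simp)

theorem isNegInvariant_withDensity_of_even {q : ℝ → ℝ≥0∞}
    (hqe : ∀ z, q (-z) = q z) : (volume.withDensity q).IsNegInvariant := by
  constructor
  ext s hs
  rw [Measure.neg_apply, withDensity_apply _ hs, withDensity_apply _ hs.neg,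
    ← lintegral_indicator hs, ← lintegral_indicator hs.neg, ← lintegral_neg_eq_self]
  refine lintegral_congr fun t => ?_
  by_cases h : t ∈ s
  · rw [indicator_of_mem h, indicator_of_mem (by simpa using h), hqe]
  · rw [indicator_of_notMem h, indicator_of_notMem (by simpa using h)]

/-- The uniform law on the cube `[-1, 1]^n` is more peaked than any product law with log-concave
density at most `1/2` in each coordinate. -/
theorem lintegral_pi_withDensity_le (hq : IsLogConcave q) (hqm : Measurable q)
    (hqe : ∀ z, q (-z) = q z) (hq2 : ∀ z, q z ≤ 2⁻¹) {n : ℕ} {F : (Fin n → ℝ) → ℝ≥0∞}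
    (hF : IsLogConcave F) (he : ∀ z, F (-z) = F z) (hm : Measurable F) (hF1 : ∀ z, F z ≤ 1) :
    ∫⁻ z, F z ∂(Measure.pi fun _ => volume.withDensity q) ≤
      ∫⁻ z, F z ∂(Measure.pi fun _ =>
        volume.withDensity ((Icc (-1 : ℝ) 1).indicator fun _ => 2⁻¹)) := by
  induction n with
  | zero => rw [Measure.pi_of_empty _ 0, Measure.pi_of_empty _ 0]
  | succ n ih =>
    set μ := volume.withDensity ((Icc (-1 : ℝ) 1).indicator fun _ => (2⁻¹ : ℝ≥0∞)) with hμ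
    set γ := volume.withDensity q
    have hcons : Measurable fun z : ℝ × (Fin n → ℝ) => F (Fin.cons z.1 z.2) :=
      hm.comp measurable_finCons
    have hL : IsLogConcave fun z : ℝ × (Fin n → ℝ) => F (Fin.cons z.1 z.2) :=
      hF.comp_linearMap (finConsLinearMap n)
    have hneg : ∀ (t : ℝ) (z : Fin n → ℝ), F (Fin.cons (-t) (-z)) = F (Fin.cons t z) := by
      intro t z
      rw [← he]
      congr 1
      ext i
      refine Fin.cases ?_ (fun j => ?_) i <;> simp
    have := isNegInvariant_withDensity_of_even hqe
    have : μ.IsNegInvariant := by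
      refine isNegInvariant_withDensity_of_even fun z => ?_
      have : -z ∈ Icc (-1 : ℝ) 1 ↔ z ∈ Icc (-1 : ℝ) 1 := by
        simp only [mem_Icc]
        constructor <;> rintro ⟨h1, h2⟩ <;> constructor <;> linarith
      simp only [indicator, this]
    -- Replace the law of the first coordinate, then the others by induction. Each partial integral
    -- is log-concave by Prékopa, and even because the law integrated out is symmetric.
    rw [lintegral_pi_succ hm, lintegral_pi_succ hm, lintegral_lintegral_swap]
    · calc _ ≤ ∫⁻ t, ∫⁻ z, F (Fin.cons t z) ∂(Measure.pi fun _ : Fin n => γ) ∂μ := by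
            refine lintegral_withDensity_le_of_even hqm hq2 ?_ ?_ ?_
            · exact hq.lintegral_pi hqm (by simp) hq2
                (hL.comp_linearMap ((LinearMap.snd ℝ _ _).prod (LinearMap.fst ℝ _ _)))
                (hcons.comp measurable_swap) fun z => hF1 _
            · intro t
              rw [← lintegral_neg_eq_self]
              simp only [hneg]
            · exact hcons.lintegral_prod_right'
        _ = ∫⁻ z, ∫⁻ t, F (Fin.cons t z) ∂μ ∂(Measure.pi fun _ : Fin n => γ) :=
            lintegral_lintegral_swap hcons.aemeasurable
        _ ≤ _ := by
            refine ih ?_ ?_ ?_ ?_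
            · exact hL.lintegral_withDensity (fun x => hcons.comp measurable_prodMk_right)
                ENNReal.one_ne_top (fun z => hF1 _)
                (.indicator_const (convex_Icc _ _) _) (measurable_const.indicator measurableSet_Icc)
                (N := 2⁻¹) (by simp) (indicator_le_self' (by simp))
            · intro z
              rw [← lintegral_neg_eq_self]
              simp only [hneg]
            · exact hcons.lintegral_prod_left'
            · exact fun t => (lintegral_mono fun z => hF1 _).trans (by simp)
    · exact (hcons.comp measurable_swap).aemeasurable

end

/-! ### Packing on the torus: the upper bound -/

/-- Half-open intervals, equal to the closed ones up to null sets, let translates of `(0, 1]^n` tile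
the cube exactly. -/
theorem pi_uniform_eq (n : ℕ) :
    (Measure.pi fun _ : Fin n =>
      volume.withDensity ((Icc (-1 : ℝ) 1).indicator fun _ => (2⁻¹ : ℝ≥0∞))) =
    (2⁻¹ : ℝ≥0∞) ^ n • (volume : Measure (Fin n → ℝ)).restrict
      (univ.pi fun _ => Ioc (-1 : ℝ) 1) := by
  refine Measure.pi_eq fun s hs => ?_
  rw [Measure.smul_apply, volume_pi, Measure.restrict_pi_pi, Measure.pi_pi, smul_eq_mul]
  have : ∀ i, (volume.withDensity ((Icc (-1 : ℝ) 1).indicator fun _ => (2⁻¹ : ℝ≥0∞))) (s i) =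
      2⁻¹ * (volume.restrict (Ioc (-1 : ℝ) 1)) (s i) := by
    intro i
    rw [Measure.restrict_congr_set Ioc_ae_eq_Icc, withDensity_indicator measurableSet_Icc,
      withDensity_const, Measure.smul_apply, smul_eq_mul]
  simp [this, Finset.prod_mul_distrib]

section Torus

variable {n : ℕ} {κ : Type*}

/-- The endomorphism of tori induced by an integer matrix. -/
noncomputable def torusHom (A : Matrix κ (Fin n) ℤ) :
    (Fin n → UnitAddCircle) →+ (κ → UnitAddCircle) where
  toFun τ i := ∑ j, A i j • τ j
  map_zero' := by ext; simp
  map_add' x y := by ext i; simp [Finset.sum_add_distrib]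

theorem torusHom_coe (A : Matrix κ (Fin n) ℤ) (z : Fin n → ℝ) (i : κ) :
    torusHom A (fun j => (z j : UnitAddCircle)) i =
      ((∑ j, (A i j : ℝ) * z j : ℝ) : UnitAddCircle) := by
  simp only [torusHom, AddMonoidHom.coe_mk, ZeroHom.coe_mk, ← zsmul_eq_mul]
  rw [← QuotientAddGroup.mk'_apply, map_sum]
  simp

/-- Surjectivity over `ℝ` descends to the tori, and a continuous surjective homomorphism of compact
groups carries Haar probability to Haar probability. -/
theorem torusHom_measurePreserving [Fintype κ] (A : Matrix κ (Fin n) ℤ)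
    (hA : Function.Surjective (A.map (Int.cast : ℤ → ℝ)).mulVec) :
    MeasurePreserving (torusHom A) volume volume := by
  have hu : (volume : Measure UnitAddCircle) univ = 1 := by simp
  refine AddMonoidHom.measurePreserving ?_ ?_ ?_
  · refine continuous_pi fun i => ?_
    simp only [torusHom, AddMonoidHom.coe_mk, ZeroHom.coe_mk]
    fun_prop
  · intro y
    choose z hz using fun i => QuotientAddGroup.mk_surjective (y i)
    obtain ⟨x, hx⟩ := hA z
    refine ⟨fun j => (x j : UnitAddCircle), ?_⟩
    ext i
    rw [torusHom_coe, ← hz i, ← hx]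
    rfl
  · simp [volume_pi, Measure.pi_univ, hu]

theorem volume_torusHom_le [Fintype κ] (A : Matrix κ (Fin n) ℤ)
    (hA : Function.Surjective (A.map (Int.cast : ℤ → ℝ)).mulVec) (δ : ℝ) :
    volume ({z : Fin n → ℝ | ∀ i, ‖((∑ j, (A i j : ℝ) * z j : ℝ) : UnitAddCircle)‖ ≤ δ} ∩
      univ.pi fun _ => Ioc (0 : ℝ) 1) ≤ ENNReal.ofReal (2 * δ) ^ Fintype.card κ := by
  have h1 : MeasurePreserving (fun (z : Fin n → ℝ) j => (z j : UnitAddCircle))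
      (volume.restrict (univ.pi fun _ => Ioc (0 : ℝ) 1)) volume := by
    rw [volume_pi, Measure.restrict_pi_pi]
    refine measurePreserving_pi _ _ fun i => ?_
    simpa using UnitAddCircle.measurePreserving_mk 0
  have h2 := (torusHom_measurePreserving A hA).comp h1
  have hm : MeasurableSet (univ.pi fun _ : κ => Metric.closedBall (0 : UnitAddCircle) δ) :=
    MeasurableSet.univ_pi fun i => measurableSet_closedBall
  have h3 := h2.measure_preimage hm.nullMeasurableSet
  rw [Measure.restrict_apply (h2.measurable hm), volume_pi, volume_pi, Measure.pi_pi] at h3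
  rw [volume_pi]
  have h4 : (torusHom A ∘ fun (z : Fin n → ℝ) j => (z j : UnitAddCircle)) ⁻¹'
      (univ.pi fun _ : κ => Metric.closedBall (0 : UnitAddCircle) δ) =
      {z : Fin n → ℝ | ∀ i, ‖((∑ j, (A i j : ℝ) * z j : ℝ) : UnitAddCircle)‖ ≤ δ} := by
    ext z
    simp [torusHom_coe]
  rw [h4] at h3
  rw [h3, Finset.prod_const, Finset.card_univ]
  gcongr
  rw [AddCircle.volume_closedBall]
  exact ENNReal.ofReal_le_ofReal (min_le_right _ _)

end Torus

/-- If an integer matrix is injective on the vertices of the cube, a small box around the origin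
has small measure for the image of the uniform law on the cube `[-1, 1]^n`. -/
theorem pi_uniform_le_of_injective {n : ℕ} {κ : Type*} [Fintype κ] (A : Matrix κ (Fin n) ℤ)
    (hA : Function.Surjective (A.map (Int.cast : ℤ → ℝ)).mulVec)
    (hEQ : ∀ x : Fin n → ℤ, (∀ j, x j ∈ ({-1, 0, 1} : Set ℤ)) → A.mulVec x = 0 → x = 0)
    {δ : ℝ} (hδ : δ < 1 / 2) :
    (Measure.pi fun _ : Fin n =>
      volume.withDensity ((Icc (-1 : ℝ) 1).indicator fun _ => (2⁻¹ : ℝ≥0∞)))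
      {z | ∀ i, |∑ j, (A i j : ℝ) * z j| ≤ δ} ≤
    (2⁻¹ : ℝ≥0∞) ^ n * ENNReal.ofReal (2 * δ) ^ Fintype.card κ := by
  set S : Set (Fin n → ℝ) := {z | ∀ i, |∑ j, (A i j : ℝ) * z j| ≤ δ} with hS
  have hSm : MeasurableSet S := by
    simp only [hS, ofPred_forall]
    refine MeasurableSet.iInter fun i => ?_
    exact measurableSet_le (by fun_prop) measurable_const
  -- `D s` is the part of `S` in the unit cube `e s + (0, 1]^n`, translated back to `(0, 1]^n`.
  let e : (Fin n → Bool) → Fin n → ℤ := fun s j => if s j then -1 else 0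
  let D : (Fin n → Bool) → Set (Fin n → ℝ) := fun s =>
    {z | ∀ i, |∑ j, (A i j : ℝ) * (z j + e s j)| ≤ δ} ∩ univ.pi fun _ => Ioc (0 : ℝ) 1
  have hDm : ∀ s, MeasurableSet (D s) := by
    intro s
    refine MeasurableSet.inter ?_ (MeasurableSet.univ_pi fun _ => measurableSet_Ioc)
    simp only [ofPred_forall]
    refine MeasurableSet.iInter fun i => ?_
    exact measurableSet_le (by fun_prop) measurable_const
  have hsum : ∀ (i : κ) (z : Fin n → ℝ) (s : Fin n → Bool),
      ∑ j, (A i j : ℝ) * (z j + e s j) =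
        ∑ j, (A i j : ℝ) * z j + ((A.mulVec (e s) i : ℤ) : ℝ) := by
    intro i z s
    simp [Matrix.mulVec, dotProduct, mul_add, Finset.sum_add_distrib]
  have hdisj : Pairwise (Function.onFun Disjoint D) := by
    intro s t hst
    refine Set.disjoint_left.2 fun z hz hz' => hst ?_
    -- A common point makes this an integer vector with entries at most `2δ < 1` in absolute value.
    have h0 : A.mulVec (e s - e t) = 0 := by
      ext i
      rw [Matrix.mulVec_sub, Pi.sub_apply, Pi.zero_apply, ← Int.abs_lt_one_iff]
      have h1 := hz.1 i
      have h2 := hz'.1 i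
      rw [hsum, abs_le] at h1 h2
      have : |((A.mulVec (e s) i - A.mulVec (e t) i : ℤ) : ℝ)| < 1 := by
        push_cast
        rw [abs_lt]
        constructor <;> linarith [h1.1, h1.2, h2.1, h2.2]
      exact_mod_cast this
    have := hEQ _ (fun j => ?_) h0
    · ext j
      have h3 := congrFun this j
      simp only [e, Pi.sub_apply, Pi.zero_apply] at h3
      revert h3
      cases s j <;> cases t j <;> simp
    · simp only [e, Pi.sub_apply]
      cases s j <;> cases t j <;> simp
  have hcover : S ∩ (univ.pi fun _ => Ioc (-1 : ℝ) 1) ⊆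
      ⋃ s, (fun (z : Fin n → ℝ) => z + fun j => -(e s j : ℝ)) ⁻¹' D s := by
    rintro z ⟨hz, hz'⟩
    refine mem_iUnion.2 ⟨fun j => decide (z j ≤ 0), ?_, ?_⟩
    · simpa [hS] using hz
    · intro j _
      have := hz' j (mem_univ j)
      by_cases h : z j ≤ 0
      · simp only [Pi.add_apply, e, h, decide_true, if_true, mem_Ioc]
        push_cast
        constructor <;> linarith [this.1]
      · simp only [Pi.add_apply, e, h, mem_Ioc]
        simp
        exact ⟨not_le.1 h, this.2⟩
  rw [pi_uniform_eq, Measure.smul_apply, smul_eq_mul, Measure.restrict_apply hSm]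
  gcongr
  calc volume (S ∩ univ.pi fun _ => Ioc (-1 : ℝ) 1)
      ≤ ∑ s, volume ((fun (z : Fin n → ℝ) => z + fun j => -(e s j : ℝ)) ⁻¹' D s) :=
        (measure_mono hcover).trans ((measure_iUnion_le _).trans_eq (tsum_fintype _))
    _ = ∑ s, volume (D s) := by simp only [measure_preimage_add_right]
    _ = volume (⋃ s, D s) := by rw [measure_iUnion hdisj hDm, tsum_fintype]
    _ ≤ _ := (measure_mono (iUnion_subset fun s => ?_)).trans (volume_torusHom_le A hA δ)
  refine inter_subset_inter_left _ fun z hz i => ?_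
  have h1 := hz i
  rw [hsum] at h1
  have : ((∑ j, (A i j : ℝ) * z j : ℝ) : UnitAddCircle) =
      ((∑ j, (A i j : ℝ) * z j + ((A.mulVec (e s) i : ℤ) : ℝ) : ℝ) : UnitAddCircle) := by
    rw [AddCircle.coe_add]
    simp
  rw [this]
  exact (QuotientAddGroup.norm_mk_le_norm).trans h1

/-! ### Gaussian measure of small boxes: the lower bound -/

/-- The product outer measure is the largest one satisfying these bounds on rectangles. -/
theorem MeasureTheory.Measure.le_pi_of_forall_rectangle {ι : Type*} [Fintype ι] {α : ι → Type*}
    [∀ i, MeasurableSpace (α i)] {μ : ∀ i, Measure (α i)} {ν : Measure (∀ i, α i)}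
    (h : ∀ s : ∀ i, Set (α i), ν (univ.pi s) ≤ ∏ i, μ i (s i)) : ν ≤ Measure.pi μ := by
  refine Measure.le_iff.2 fun s hs => ?_
  rw [Measure.pi_def, toMeasure_apply _ _ hs]
  exact (OuterMeasure.le_pi (m := fun i => (μ i).toOuterMeasure) (n := ν.toOuterMeasure)).2
    (fun t _ => h t) s

/-- The law `N(0, 2/π)`, whose density has maximum `1/2`. -/
noncomputable def peakGaussian : Measure ℝ := gaussianReal 0 (2 / NNReal.pi)

/-- The density of `N(0, 2/π)`. -/
noncomputable def peakGaussianPDF (x : ℝ) : ℝ≥0∞ :=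
  ENNReal.ofReal (2⁻¹ * Real.exp (-(Real.pi / 4) * x ^ 2))

theorem peakGaussian_eq : peakGaussian = volume.withDensity peakGaussianPDF := by
  have hv : (2 / NNReal.pi : ℝ≥0) ≠ 0 := by simp [NNReal.pi_ne_zero]
  rw [peakGaussian, gaussianReal_of_var_ne_zero _ hv]
  congr 1
  ext x
  have h4 : √(2 * Real.pi * (2 / Real.pi)) = 2 := by
    rw [show 2 * Real.pi * (2 / Real.pi) = 2 ^ 2 by field_simp]
    exact Real.sqrt_sq (by norm_num)
  simp only [gaussianPDF, gaussianPDFReal, peakGaussianPDF, NNReal.coe_div, NNReal.coe_ofNat,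
    NNReal.coe_real_pi, h4, sub_zero]
  congr 3
  field_simp
  norm_num

instance : IsProbabilityMeasure peakGaussian := by
  unfold peakGaussian
  infer_instance

instance : IsProbabilityMeasure (volume.withDensity peakGaussianPDF) := by
  rw [← peakGaussian_eq]
  infer_instance

theorem measurable_peakGaussianPDF : Measurable peakGaussianPDF := by
  unfold peakGaussianPDF
  fun_prop

theorem peakGaussianPDF_neg (x : ℝ) : peakGaussianPDF (-x) = peakGaussianPDF x := by
  simp [peakGaussianPDF]

theorem peakGaussianPDF_le_of_abs_le {x y : ℝ} (h : |x| ≤ |y|) :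
    peakGaussianPDF y ≤ peakGaussianPDF x := by
  have h2 := sq_le_sq.2 h
  have := mul_le_mul_of_nonneg_left h2 (div_nonneg Real.pi_pos.le zero_le_four)
  exact ENNReal.ofReal_le_ofReal
    (mul_le_mul_of_nonneg_left (Real.exp_le_exp.2 (by linarith)) (by norm_num))

theorem peakGaussianPDF_zero : peakGaussianPDF 0 = 2⁻¹ := by
  simp [peakGaussianPDF, ENNReal.ofReal_inv_of_pos]

theorem peakGaussianPDF_le (x : ℝ) : peakGaussianPDF x ≤ 2⁻¹ :=
  (peakGaussianPDF_le_of_abs_le (by simp)).trans_eq peakGaussianPDF_zero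

theorem isLogConcave_peakGaussianPDF : IsLogConcave peakGaussianPDF := by
  intro x y a b ha hb hab
  simp only [peakGaussianPDF, smul_eq_mul]
  rw [ENNReal.ofReal_rpow_of_nonneg (by positivity) ha.le,
    ENNReal.ofReal_rpow_of_nonneg (by positivity) hb.le,
    ← ENNReal.ofReal_mul (by positivity)]
  refine ENNReal.ofReal_le_ofReal ?_
  rw [Real.mul_rpow (by positivity) (by positivity), Real.mul_rpow (by positivity) (by positivity),
    mul_mul_mul_comm, ← Real.rpow_add (by positivity), hab, Real.rpow_one, ← Real.exp_mul,
    ← Real.exp_mul, ← Real.exp_add]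
  gcongr
  obtain rfl : b = 1 - a := by linarith
  -- This is exactly the difference of the two exponents.
  have : 0 ≤ Real.pi / 4 * (a * (1 - a) * (x - y) ^ 2) := by positivity
  linarith

theorem measurable_mulVec {ι κ : Type*} [Fintype ι] [Fintype κ] (A : Matrix κ ι ℝ) :
    Measurable A.mulVec :=
  (Continuous.matrix_mulVec continuous_const continuous_id).measurable

/-- The matrix enters only through `A * Aᵀ`, so a rectangular matrix can be traded for a square one.
-/
theorem charFun_map_mulVec_pi_peakGaussian {ι κ : Type*} [Fintype ι] [Fintype κ]
    (A : Matrix κ ι ℝ) (t : EuclideanSpace ℝ κ) :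
    charFun (((Measure.pi fun _ => peakGaussian).map A.mulVec).map (WithLp.toLp 2)) t =
      Complex.exp (-(2 / NNReal.pi : ℝ≥0) * (t.ofLp ⬝ᵥ (A * Aᵀ) *ᵥ t.ofLp : ℝ) / 2) := by
  have e1 : charFun (((Measure.pi fun _ => peakGaussian).map A.mulVec).map (WithLp.toLp 2)) t =
      charFun ((Measure.pi fun _ => peakGaussian).map (WithLp.toLp 2))
        (WithLp.toLp 2 (Aᵀ *ᵥ t.ofLp)) := by
    rw [Measure.map_map (by fun_prop) (measurable_mulVec A), charFun_apply, charFun_apply,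
      integral_map ((by fun_prop : Measurable (WithLp.toLp 2)).comp (measurable_mulVec A)).aemeasurable
        (by fun_prop), integral_map (by fun_prop) (by fun_prop)]
    refine integral_congr_ae (Filter.Eventually.of_forall fun z => ?_)
    have : inner ℝ (WithLp.toLp 2 (A.mulVec z)) t =
        inner ℝ (WithLp.toLp 2 z) (WithLp.toLp 2 (Aᵀ *ᵥ t.ofLp)) := by
      simp only [EuclideanSpace.inner_eq_star_dotProduct, star_trivial]
      rw [Matrix.dotProduct_mulVec, Matrix.mulVec_transpose, ← Matrix.dotProduct_mulVec]
    simp only [Function.comp_apply, this]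
  rw [e1, charFun_pi]
  simp only [peakGaussian, charFun_gaussianReal]
  rw [← Complex.exp_sum]
  congr 1
  rw [← Matrix.mulVec_mulVec, Matrix.dotProduct_mulVec, ← Matrix.mulVec_transpose]
  simp only [dotProduct, Complex.ofReal_sum, Complex.ofReal_mul, Finset.mul_sum,
    Finset.sum_div]
  refine Finset.sum_congr rfl fun i _ => ?_
  push_cast
  ring

/-- Two linear images of a product Gaussian law agree if the covariance matrices agree. -/
theorem map_mulVec_pi_peakGaussian_eq {ι ι' κ : Type*} [Fintype ι] [Fintype ι'] [Fintype κ]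
    (A : Matrix κ ι ℝ) (B : Matrix κ ι' ℝ) (h : A * Aᵀ = B * Bᵀ) :
    (Measure.pi fun _ => peakGaussian).map A.mulVec =
      (Measure.pi fun _ => peakGaussian).map B.mulVec := by
  have h2 : ((Measure.pi fun _ => peakGaussian).map A.mulVec).map (WithLp.toLp 2) =
      ((Measure.pi fun _ => peakGaussian).map B.mulVec).map
        (WithLp.toLp 2 : _ → EuclideanSpace ℝ κ) := by
    have := Measure.isProbabilityMeasure_map (μ := Measure.pi fun _ => peakGaussian)
      (measurable_mulVec A).aemeasurable
    have := Measure.isProbabilityMeasure_map (μ := Measure.pi fun _ => peakGaussian)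
      (measurable_mulVec B).aemeasurable
    refine Measure.ext_of_charFun ?_
    ext t
    rw [charFun_map_mulVec_pi_peakGaussian, charFun_map_mulVec_pi_peakGaussian, h]
  have h3 := congrArg (Measure.map (WithLp.ofLp : EuclideanSpace ℝ κ → κ → ℝ)) h2
  have hid : (WithLp.ofLp : EuclideanSpace ℝ κ → κ → ℝ) ∘ WithLp.toLp 2 = id := rfl
  simpa only [Measure.map_map (WithLp.measurable_ofLp 2 _) (WithLp.measurable_toLp 2 _), hid,
    Measure.map_id] using h3

section

variable {κ : Type*} [Fintype κ]

theorem smul_restrict_le_pi_peakGaussian {η : ℝ} :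
    peakGaussianPDF η ^ Fintype.card κ •
      (volume : Measure (κ → ℝ)).restrict (univ.pi fun _ => Icc (-η) η) ≤
        Measure.pi fun _ => peakGaussian := by
  have h1 : ∀ s : Set ℝ, peakGaussianPDF η * (volume.restrict (Icc (-η) η)) s ≤
      peakGaussian s := by
    intro s
    rw [← smul_eq_mul, ← Measure.smul_apply]
    refine Measure.le_iff'.1 ?_ s
    rw [peakGaussian_eq, ← withDensity_const, ← withDensity_indicator measurableSet_Icc]
    refine withDensity_mono (Filter.Eventually.of_forall fun x => ?_)
    refine indicator_le' (g := peakGaussianPDF) (fun y hy => peakGaussianPDF_le_of_abs_le ?_)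
      (fun _ _ => zero_le) x
    exact (abs_le.2 hy).trans (le_abs_self η)
  refine Measure.le_pi_of_forall_rectangle fun s => ?_
  rw [volume_pi, Measure.restrict_pi_pi, Measure.smul_apply, Measure.pi_pi, smul_eq_mul,
    ← Finset.card_univ, ← Finset.prod_const, ← Finset.prod_mul_distrib]
  exact Finset.prod_le_prod' fun i _ => h1 (s i)

/-- The set has volume `|det B|⁻¹ (2δ)^r` and lies in a box of half-width `C δ`, on which the
density is at least its corner value. `C` is independent of `δ`, so this value tends to the peak
`2^(-r)`. -/
theorem le_pi_peakGaussian_mulVec [DecidableEq κ] (B : Matrix κ κ ℝ) (hB : B.det ≠ 0) :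
    ∃ C : ℝ, ∀ δ : ℝ, 0 ≤ δ →
      peakGaussianPDF (C * δ) ^ Fintype.card κ *
        (ENNReal.ofReal |B.det⁻¹| * ENNReal.ofReal (2 * δ) ^ Fintype.card κ) ≤
        (Measure.pi fun _ => peakGaussian) {y | ∀ i, |(B *ᵥ y) i| ≤ δ} := by
  refine ⟨∑ i, ∑ j, |B⁻¹ i j|, fun δ hδ => ?_⟩
  have hset : {y | ∀ i, |(B *ᵥ y) i| ≤ δ} =
      Matrix.toLin' B ⁻¹' (univ.pi fun _ => Icc (-δ) δ) := by
    ext y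
    simp only [mem_ofPred_eq, mem_preimage, mem_univ_pi, Matrix.toLin'_apply, mem_Icc, abs_le]
  have hsub : {y | ∀ i, |(B *ᵥ y) i| ≤ δ} ⊆
      univ.pi fun _ => Icc (-((∑ i, ∑ j, |B⁻¹ i j|) * δ)) ((∑ i, ∑ j, |B⁻¹ i j|) * δ) := by
    intro y hy i _
    have e : y = B⁻¹ *ᵥ (B *ᵥ y) := by
      rw [Matrix.mulVec_mulVec, Matrix.nonsing_inv_mul _ hB.isUnit, Matrix.one_mulVec]
    refine mem_Icc.2 (abs_le.1 ?_)
    calc |y i| = |∑ j, B⁻¹ i j * (B *ᵥ y) j| := by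
          conv_lhs => rw [e]
          rfl
      _ ≤ ∑ j, |B⁻¹ i j| * δ := by
          refine (Finset.abs_sum_le_sum_abs _ _).trans (Finset.sum_le_sum fun j _ => ?_)
          rw [abs_mul]
          exact mul_le_mul_of_nonneg_left (hy j) (abs_nonneg _)
      _ ≤ _ := by
          rw [← Finset.sum_mul]
          refine mul_le_mul_of_nonneg_right ?_ hδ
          exact Finset.single_le_sum (f := fun i => ∑ j, |B⁻¹ i j|)
            (fun _ _ => Finset.sum_nonneg fun _ _ => abs_nonneg _) (Finset.mem_univ i)
  refine le_trans (le_of_eq ?_) (Measure.le_iff'.1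
    (smul_restrict_le_pi_peakGaussian (η := (∑ i, ∑ j, |B⁻¹ i j|) * δ)) _)
  have hbox : volume (univ.pi fun _ : κ => Icc (-δ) δ) =
      ENNReal.ofReal (2 * δ) ^ Fintype.card κ := by
    rw [volume_pi, Measure.pi_pi]
    simp [two_mul]
  rw [Measure.smul_apply, smul_eq_mul, Measure.restrict_eq_self _ hsub, hset,
    Measure.addHaar_preimage_linearMap _ (by rwa [LinearMap.det_toLin']), LinearMap.det_toLin',
    hbox]

end

/-! ### The Gram determinant and the conclusion -/

/-- AM–GM for the eigenvalues, whose mean is the trace divided by the size, hence at most `c`. -/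
theorem Matrix.PosSemidef.det_le_pow_of_diag_le {κ : Type*} [Fintype κ] [DecidableEq κ]
    {S : Matrix κ κ ℝ} (hS : S.PosSemidef) {c : ℝ} (h : ∀ i, S i i ≤ c) :
    S.det ≤ c ^ Fintype.card κ := by
  rcases isEmpty_or_nonempty κ with hκ | hκ
  · simp
  have hr : (0 : ℝ) < Fintype.card κ := by exact_mod_cast Fintype.card_pos
  have hnn := hS.eigenvalues_nonneg
  have hamgm := Real.geom_mean_le_arith_mean Finset.univ (fun _ => 1) hS.isHermitian.eigenvalues
    (fun _ _ => zero_le_one) (by simpa using hr) (fun i _ => hnn i)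
  have htr := hS.isHermitian.trace_eq_sum_eigenvalues
  simp only [Real.rpow_one, Finset.sum_const, Finset.card_univ, nsmul_eq_mul, mul_one,
    one_mul] at hamgm
  simp only [RCLike.ofReal_real_eq_id, id_eq] at htr
  have hsum : (∑ i, hS.isHermitian.eigenvalues i) / Fintype.card κ ≤ c := by
    rw [← htr, div_le_iff₀ hr, mul_comm]
    simpa [Matrix.trace] using Finset.sum_le_card_nsmul Finset.univ (fun i => S i i) c fun i _ => h i
  rw [hS.isHermitian.det_eq_prod_eigenvalues]
  simp only [RCLike.ofReal_real_eq_id, id_eq]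
  have hp : 0 ≤ ∏ i, hS.isHermitian.eigenvalues i := Finset.prod_nonneg fun i _ => hnn i
  rw [← Real.rpow_natCast]
  have hc : 0 ≤ c := (div_nonneg (Finset.sum_nonneg fun i _ => hnn i) hr.le).trans hsum
  exact (Real.rpow_inv_le_iff_of_pos hp hc hr).1 (hamgm.trans hsum)

/-- Vaaler's cube slicing inequality combined with a packing argument bounds the Gram determinant
of an integer matrix that is injective on the vertices of the cube. -/
theorem four_pow_le_mul_det_of_injective {n : ℕ} {κ : Type*} [Fintype κ] [DecidableEq κ]
    (A : Matrix κ (Fin n) ℤ)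
    (hA : LinearIndependent ℝ (A.map (Int.cast : ℤ → ℝ)).row)
    (hEQ : ∀ x : Fin n → ℤ, (∀ j, x j ∈ ({-1, 0, 1} : Set ℤ)) → A.mulVec x = 0 → x = 0) :
    (4 : ℝ) ^ n ≤ 4 ^ Fintype.card κ *
      ((A.map (Int.cast : ℤ → ℝ)) * (A.map (Int.cast : ℤ → ℝ))ᵀ).det := by
  set R := A.map (Int.cast : ℤ → ℝ) with hR
  set r := Fintype.card κ
  have hpd : (R * Rᵀ).PosDef := by
    simpa using Matrix.PosDef.mul_conjTranspose_self R (Matrix.vecMul_injective_iff.2 hA)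
  have hsurj : Function.Surjective R.mulVec := by
    intro y
    refine ⟨Rᵀ *ᵥ ((R * Rᵀ)⁻¹ *ᵥ y), ?_⟩
    rw [Matrix.mulVec_mulVec, Matrix.mulVec_mulVec, Matrix.mul_nonsing_inv _ hpd.det_pos.ne'.isUnit,
      Matrix.one_mulVec]
  -- `Cᵀ` is a square invertible matrix with the same Gram matrix as `R`, so both have the same
  -- Gaussian image.
  obtain ⟨C, hC⟩ := CStarAlgebra.nonneg_iff_eq_star_mul_self.1
    (Matrix.nonneg_iff_posSemidef.2 hpd.posSemidef)
  have hB : R * Rᵀ = Cᵀ * Cᵀᵀ := by simpa [Matrix.star_eq_conjTranspose] using hC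
  have hdet : (R * Rᵀ).det = Cᵀ.det ^ 2 := by
    rw [hB, Matrix.det_mul, Matrix.det_transpose Cᵀ, sq]
  have hB0 : Cᵀ.det ≠ 0 := by
    intro h0
    have := hpd.det_pos
    simp [hdet, h0] at this
  obtain ⟨K, hK⟩ := le_pi_peakGaussian_mulVec Cᵀ hB0
  have hbound : ∀ δ ∈ Ioo (0 : ℝ) (1 / 2), peakGaussianPDF (K * δ) ^ r *
      ENNReal.ofReal |(Cᵀ).det⁻¹| ≤ 2⁻¹ ^ n := by
    intro δ hδ
    have hSm : MeasurableSet {y : κ → ℝ | ∀ i, |y i| ≤ δ} := by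
      simp only [ofPred_forall]
      exact MeasurableSet.iInter fun i => measurableSet_le (by fun_prop) measurable_const
    have hconv : Convex ℝ {z : Fin n → ℝ | ∀ i, |(R *ᵥ z) i| ≤ δ} := by
      intro x hx y hy a b ha hb hab i
      rw [Matrix.mulVec_add, Matrix.mulVec_smul, Matrix.mulVec_smul]
      simp only [Pi.add_apply, Pi.smul_apply, smul_eq_mul]
      have h1 := abs_le.1 (hx i)
      have h2 := abs_le.1 (hy i)
      have h3 : b = 1 - a := by linarith
      rw [abs_le]
      constructor <;> nlinarith
    have hTm : MeasurableSet {z : Fin n → ℝ | ∀ i, |(R *ᵥ z) i| ≤ δ} := measurable_mulVec R hSm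
    have hpos : ENNReal.ofReal (2 * δ) ^ r ≠ 0 := by
      exact pow_ne_zero _ (by simpa using hδ.1)
    have hlaw := congrArg (fun μ => μ {y : κ → ℝ | ∀ i, |y i| ≤ δ})
      (map_mulVec_pi_peakGaussian_eq R Cᵀ hB)
    simp only [Measure.map_apply (measurable_mulVec _) hSm, preimage_ofPred_eq] at hlaw
    have hcmp := lintegral_pi_withDensity_le isLogConcave_peakGaussianPDF
      measurable_peakGaussianPDF peakGaussianPDF_neg peakGaussianPDF_le
      (.indicator_const hconv 1) (fun z => by simp [indicator, Matrix.mulVec_neg])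
      (measurable_const.indicator hTm) (indicator_le' (by simp) (by simp))
    rw [lintegral_indicator_const hTm, lintegral_indicator_const hTm, one_mul, one_mul,
      ← peakGaussian_eq] at hcmp
    have hup := pi_uniform_le_of_injective A hsurj hEQ hδ.2
    have := (((hK δ hδ.1.le).trans_eq hlaw.symm).trans hcmp).trans hup
    rw [← mul_assoc] at this
    exact (ENNReal.mul_le_mul_iff_left hpos (by finiteness)).1 this
  have hlim : (2⁻¹ : ℝ≥0∞) ^ r * ENNReal.ofReal |(Cᵀ).det⁻¹| ≤ 2⁻¹ ^ n := by
    have hcont : Continuous fun δ : ℝ => peakGaussianPDF (K * δ) ^ r := by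
      unfold peakGaussianPDF
      exact (ENNReal.continuous_pow r).comp (ENNReal.continuous_ofReal.comp (by fun_prop))
    have ht : Tendsto (fun δ : ℝ => peakGaussianPDF (K * δ) ^ r * ENNReal.ofReal |(Cᵀ).det⁻¹|)
        (𝓝[>] 0) (𝓝 (2⁻¹ ^ r * ENNReal.ofReal |(Cᵀ).det⁻¹|)) := by
      refine ENNReal.Tendsto.mul_const ?_ (.inr ENNReal.ofReal_ne_top)
      have := hcont.tendsto 0
      rw [mul_zero, peakGaussianPDF_zero] at this
      exact this.mono_left nhdsWithin_le_nhds
    exact le_of_tendsto ht (eventually_of_mem (Ioo_mem_nhdsGT (by norm_num)) hbound)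
  have hreal : (2⁻¹ : ℝ) ^ r * |(Cᵀ).det⁻¹| ≤ 2⁻¹ ^ n := by
    have := ENNReal.toReal_mono (by finiteness) hlim
    simpa using this
  have h2 : (2 : ℝ) ^ n ≤ 2 ^ r * |(Cᵀ).det| := by
    have hd : 0 < |(Cᵀ).det| := abs_pos.2 hB0
    rw [abs_inv, inv_pow, inv_pow, ← mul_inv] at hreal
    exact (inv_le_inv₀ (by positivity) (by positivity)).1 hreal
  have h3 := pow_le_pow_left₀ (by positivity) h2 2
  rw [hdet, ← sq_abs (Cᵀ).det, show (4 : ℝ) = 2 ^ 2 by norm_num, ← pow_mul, ← pow_mul,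
    mul_comm 2 n, mul_comm 2 r, pow_mul, pow_mul, ← mul_pow]
  exact h3

theorem mainTheorem6 (m n : ℕ) (hm : 0 < m) (hn : 0 < n)
    (A : Matrix (Fin m) (Fin n) ℤ)
    (hA : ∀ i j, A i j ∈ ({-1, 0, 1} : Set ℤ))
    (hEQ : IsEQMatrix A) :
    matrixRate A ≤ 1 / 2 * Real.logb 2 (n : ℝ) + 1 := by
  set R := A.map (Int.cast : ℤ → ℝ) with hR
  -- Dependent rows would make the Gram determinant vanish. The selected rows span the row space, so
  -- the kernel and the EQ property survive.
  obtain ⟨κ, a, ha, hspan, hli⟩ := exists_linearIndependent' ℝ R.row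
  have : Finite κ := Finite.of_injective a ha
  have := Fintype.ofFinite κ
  classical
  have hcard : Fintype.card κ ≤ m := by simpa using Fintype.card_le_of_injective a ha
  have hn1 : (1 : ℝ) ≤ n := by exact_mod_cast hn
  have hEQ' : ∀ x : Fin n → ℤ, (∀ j, x j ∈ ({-1, 0, 1} : Set ℤ)) →
      (A.submatrix a id).mulVec x = 0 → x = 0 := by
    intro x hx h0
    refine hEQ x hx ?_
    have hker : ∀ v ∈ Submodule.span ℝ (range R.row), v ⬝ᵥ (fun j => (x j : ℝ)) = 0 := by
      rw [← hspan]
      intro v hv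
      induction hv using Submodule.span_induction with
      | mem v hv =>
        obtain ⟨k, rfl⟩ := hv
        have := congrFun h0 k
        simp only [Matrix.mulVec, dotProduct, Matrix.submatrix_apply, id_eq, Pi.zero_apply] at this
        change ∑ j, (A (a k) j : ℝ) * (x j : ℝ) = 0
        exact_mod_cast this
      | zero => simp
      | add v w _ _ h1 h2 => rw [add_dotProduct, h1, h2, add_zero]
      | smul c v _ h1 => rw [smul_dotProduct, h1, smul_zero]
    ext i
    have := hker (R.row i) (Submodule.subset_span ⟨i, rfl⟩)
    simp only [Matrix.row, hR, dotProduct, Matrix.map_apply] at this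
    simp only [Matrix.mulVec, dotProduct, Pi.zero_apply]
    exact_mod_cast this
  have key := four_pow_le_mul_det_of_injective (A.submatrix a id) hli hEQ'
  have hdet : ((A.submatrix a id).map (Int.cast : ℤ → ℝ) *
      ((A.submatrix a id).map (Int.cast : ℤ → ℝ))ᵀ).det ≤ (n : ℝ) ^ Fintype.card κ := by
    refine Matrix.PosSemidef.det_le_pow_of_diag_le ?_ fun i => ?_
    · simpa using Matrix.posSemidef_self_mul_conjTranspose
        ((A.submatrix a id).map (Int.cast : ℤ → ℝ))
    · rw [Matrix.mul_apply]
      refine (Finset.sum_le_card_nsmul _ _ 1 fun j _ => ?_).trans (by simp)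
      change (A (a i) j : ℝ) * (A (a i) j : ℝ) ≤ 1
      rcases hA (a i) j with h | h | h <;> rw [h] <;> norm_num
  have h4 : (4 : ℝ) ^ n ≤ (4 * n) ^ m := by
    calc (4 : ℝ) ^ n ≤ (4 * n) ^ Fintype.card κ := by
          rw [mul_pow]
          exact key.trans (by gcongr)
      _ ≤ _ := pow_le_pow_right₀ (by linarith) hcard
  have hlog := Real.logb_le_logb_of_le one_lt_two (by positivity) h4
  have hl4 : Real.logb 2 4 = 2 := by
    rw [show (4 : ℝ) = 2 ^ (2 : ℝ) by norm_num, Real.logb_rpow (by norm_num) (by norm_num)]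
  rw [Real.logb_pow, Real.logb_pow, Real.logb_mul (by norm_num) (by positivity), hl4] at hlog
  rw [matrixRate, div_le_iff₀ (by exact_mod_cast hm)]
  linarith
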